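/- Let $p>1$, $a\in\mathbb R$ and $R\ge 1$, and write $\langle x\rangle=(1+x^2)^{1/2}$. Let $f\in C^2(\mathbb R)$ and $g\in C^1(\mathbb R)$ satisfy $\operatorname{supp} f,\ \operatorname{supp} g\subset\{x\in\mathbb R: |x|\le R\}$, $f(x)\ge 0$ and $g(x)\ge 0$ for all $x\in\mathbb R$, and $f\not\equiv 0$ or $g\not\equiv 0$. For $\varepsilon>0$ and $T\in(0,\infty]$ consider the Cauchy problem $$u_{tt}-u_{xx}=\frac{|u_x|^p}{\langle x\rangle^a}\ \text{ in } \mathbb R\times(0,T),\qquad u(x,0)=\varepsilon f(x),\quad u_t(x,0)=\varepsilon g(x)\quad(x\in\mathbb R).$$ A classical solution on the time interval $[0,T)$ is a function $u\in C^2(\mathbb R\times[0,T))$ satisfying these relations pointwise, and the lifespan $T(\varepsilon)$ is the supremum of all $T\in(0,\infty]$ for which a classical solution on $[0,T)$ exists. Then there exist constants $\varepsilon_1>0$ and $C>0$, depending only on $f,g,p,a,R$ (in particular, independent of $\varepsilon$), such that for every $\varepsilon\in(0,\varepsilon_1]$ there is no classical solution on $[0,T)$ whenever $T\in(0,\infty]$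 satisfies $$T>\begin{cases} C\,\varepsilon^{-(p-1)/(1-a)} & \text{if } a<1,\\ \exp\left(C\,\varepsilon^{-(p-1)}\right) & \text{if } a=1.\end{cases}$$ Consequently, for every $\varepsilon\in(0,\varepsilon_1]$, $$T(\varepsilon)\le\begin{cases} C\,\varepsilon^{-(p-1)/(1-a)} & \text{if } a<1,\\ \exp\left(C\,\varepsilon^{-(p-1)}\right) & \text{if } a=1.\end{cases}$$ -/

import Mathlib

/-- The Japanese bracket `⟨x⟩ = (1 + x²)^{1/2}`. -/
noncomputable def japaneseBracket (x : ℝ) : ℝ := Real.sqrt (1 + x ^ 2)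

/-- `u = u(x,t)` is a classical solution on `ℝ × [0,T)`, `T ∈ (0,∞]`, of
`u_tt - u_xx = |u_x|^p / ⟨x⟩^a`, `u(x,0) = ε f(x)`, `u_t(x,0) = ε g(x)`:
it is of class `C²` on `ℝ × [0,T)`, satisfies the equation pointwise in `ℝ × (0,T)`, and
takes the initial values (the time derivative at `t = 0` being one-sided).
No condition on the behaviour as `|x| → ∞` is imposed. -/
structure IsClassicalSolution (p a ε : ℝ) (f g : ℝ → ℝ) (T : EReal) (u : ℝ → ℝ → ℝ) :
    Prop where
  contDiffOn : ContDiffOn ℝ 2 (fun z : ℝ × ℝ => u z.1 z.2) {z | 0 ≤ z.2 ∧ (z.2 : EReal) < T}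
  equation : ∀ x t : ℝ, 0 < t → (t : EReal) < T →
    iteratedDeriv 2 (fun s => u x s) t - iteratedDeriv 2 (fun y => u y t) x =
      |deriv (fun y => u y t) x| ^ p / japaneseBracket x ^ a
  initial_value : ∀ x : ℝ, u x 0 = ε * f x
  initial_velocity : ∀ x : ℝ, HasDerivWithinAt (fun s => u x s) (ε * g x) (Set.Ici 0) 0

/-- The lifespan `T(ε)`: the supremum of all `T ∈ (0,∞]` such that a classical solution exists
in the time interval `[0,T)`. -/
noncomputable def lifespan (p a ε : ℝ) (f g : ℝ → ℝ) : EReal :=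
  sSup {T : EReal | 0 < T ∧ ∃ u : ℝ → ℝ → ℝ, IsClassicalSolution p a ε f g T u}

/-! The mechanism is a test function travelling with the right-going wave. Put `y = x - t` and `χ =
y + R` for `-R ≤ y ≤ R`. The profile `χ(x - t)` solves the free wave equation, `χ` vanishes at `y =
-R`, and by finite speed of propagation `u` and its first derivatives vanish at `y = R`. Testing the
equation with `η(t) χ(x - t)` thus leaves no boundary terms. The remaining linear terms contain `η'
u` and `η'' u χ`; integration by parts in `y` turns them into `η' u_x χ` and `η'' u_x χ²`, so only
`u_x` has to be controlled and no sign of `u` is needed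
(`IsSolutionWithDerivs.hasDerivAt_testFunctional`).

In the strip `|x - t| ≤ R` the weight `⟨x⟩^{-a}` is bounded below by a multiple of `q = (1 +
t)^{-a}`. Let `W` be the primitive of `q`, `S = W(T₀)`, and take `η` to be a high power of `θ = 1 -
W/S`. Then `η'` and `η''` carry the factor `q/S`, and Young's inequality absorbs the linear terms
into the nonlinearity at the cost of a multiple of `q S^{-p/(p-1)}` (`neg_le_mul_rpow_sub_mul_add`).
Since `η` and `η'` vanish at `T₀`, integration over `[0, T₀]` bounds the data, of size `ε`, by a
multiple of `S^{-1/(p-1)}` (`exists_data_le_weightPrimitive_rpow`).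

Hence `W(T₀) ≤ K ε^{-(p-1)}`. As `W` grows like `T₀^{1-a}` for `a < 1` and equals `log (1 + T₀)` for
`a = 1`, both bounds follow. -/

open Set Filter Topology MeasureTheory

/-! ### Partial derivatives of a classical solution -/

/-- `U` is a solution of `U_tt - U_xx = |U_x|^p / ⟨x⟩^a` on `0 < t < T`, with derivatives
`P = U_x`, `Q = U_t`, `Pxx = U_xx`, `Pxt = U_xt`, `Qtt = U_tt`; `U`, `P` and `Q` are continuous up
to `t = 0`, where they take the values `ε f`, `ε f'` and `ε g`. -/
structure IsSolutionWithDerivs (p a ε : ℝ) (f g : ℝ → ℝ) (T : ℝ)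
    (U P Q Pxx Pxt Qtt : ℝ × ℝ → ℝ) : Prop where
  continuousOn : ContinuousOn U {z | 0 ≤ z.2 ∧ z.2 < T}
  continuousOn_x : ContinuousOn P {z | 0 ≤ z.2 ∧ z.2 < T}
  continuousOn_t : ContinuousOn Q {z | 0 ≤ z.2 ∧ z.2 < T}
  continuousOn_xx : ContinuousOn Pxx {z | 0 < z.2 ∧ z.2 < T}
  continuousOn_xt : ContinuousOn Pxt {z | 0 < z.2 ∧ z.2 < T}
  continuousOn_tt : ContinuousOn Qtt {z | 0 < z.2 ∧ z.2 < T}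
  hasFDerivAt : ∀ z : ℝ × ℝ, 0 < z.2 → z.2 < T → HasFDerivAt U
    (P z • ContinuousLinearMap.fst ℝ ℝ ℝ + Q z • ContinuousLinearMap.snd ℝ ℝ ℝ) z
  hasFDerivAt_x : ∀ z : ℝ × ℝ, 0 < z.2 → z.2 < T → HasFDerivAt P
    (Pxx z • ContinuousLinearMap.fst ℝ ℝ ℝ + Pxt z • ContinuousLinearMap.snd ℝ ℝ ℝ) z
  hasFDerivAt_t : ∀ z : ℝ × ℝ, 0 < z.2 → z.2 < T → HasFDerivAt Q
    (Pxt z • ContinuousLinearMap.fst ℝ ℝ ℝ + Qtt z • ContinuousLinearMap.snd ℝ ℝ ℝ) z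
  equation : ∀ z : ℝ × ℝ, 0 < z.2 → z.2 < T →
    Qtt z - Pxx z = |P z| ^ p / japaneseBracket z.1 ^ a
  initial : ∀ x, U (x, 0) = ε * f x
  initial_x : ∀ x, P (x, 0) = ε * deriv f x
  initial_t : ∀ x, Q (x, 0) = ε * g x

theorem ContinuousLinearMap.eq_smul_fst_add_smul_snd (A : ℝ × ℝ →L[ℝ] ℝ) :
    A = A (1, 0) • ContinuousLinearMap.fst ℝ ℝ ℝ + A (0, 1) • ContinuousLinearMap.snd ℝ ℝ ℝ := by
  ext <;> simp

/-- The chain rule along a straight line for a function with partial derivatives `A`, `B`. -/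
theorem HasFDerivAt.hasDerivAt_line {V : ℝ × ℝ → ℝ} {A B : ℝ} {x t c d s : ℝ}
    (h : HasFDerivAt V (A • ContinuousLinearMap.fst ℝ ℝ ℝ + B • ContinuousLinearMap.snd ℝ ℝ ℝ)
      (x + c * s, t + d * s)) :
    HasDerivAt (fun r => V (x + c * r, t + d * r)) (A * c + B * d) s := by
  have h1 : HasDerivAt (fun r : ℝ => (x + c * r, t + d * r)) (c, d) s := by
    refine HasDerivAt.prodMk ?_ ?_
    · simpa using ((hasDerivAt_id s).const_mul c).const_add x
    · simpa using ((hasDerivAt_id s).const_mul d).const_add t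
  have h2 := h.comp_hasDerivAt s h1
  simpa [Function.comp_def] using h2

theorem HasFDerivAt.hasDerivAt_fst {V : ℝ × ℝ → ℝ} {A B x t : ℝ}
    (h : HasFDerivAt V (A • ContinuousLinearMap.fst ℝ ℝ ℝ + B • ContinuousLinearMap.snd ℝ ℝ ℝ)
      (x, t)) : HasDerivAt (fun y => V (y, t)) A x := by
  have := HasFDerivAt.hasDerivAt_line (x := 0) (t := t) (c := 1) (d := 0) (s := x)
    (V := V) (A := A) (B := B) (by simpa using h)
  simpa using this

theorem HasFDerivAt.hasDerivAt_snd {V : ℝ × ℝ → ℝ} {A B x t : ℝ}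
    (h : HasFDerivAt V (A • ContinuousLinearMap.fst ℝ ℝ ℝ + B • ContinuousLinearMap.snd ℝ ℝ ℝ)
      (x, t)) : HasDerivAt (fun s => V (x, s)) B t := by
  have := HasFDerivAt.hasDerivAt_line (x := x) (t := 0) (c := 0) (d := 1) (s := t)
    (V := V) (A := A) (B := B) (by simpa using h)
  simpa using this

theorem iteratedDeriv_two_eq {φ φ' : ℝ → ℝ} {c x : ℝ}
    (h : ∀ᶠ y in 𝓝 x, HasDerivAt φ (φ' y) y) (h' : HasDerivAt φ' c x) :
    iteratedDeriv 2 φ x = c := by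
  rw [iteratedDeriv_succ, iteratedDeriv_one]
  have : deriv φ =ᶠ[𝓝 x] φ' := h.mono fun y hy => hy.deriv
  rw [this.deriv_eq, h'.deriv]

/-- The half-closed strip has unique derivatives, so `fderivWithin` gives first derivatives
continuous up to `t = 0`; second derivatives are needed only in the open strip, where ordinary ones
are available. -/
theorem IsClassicalSolution.exists_isSolutionWithDerivs {p a ε T : ℝ} {f g : ℝ → ℝ}
    {u : ℝ → ℝ → ℝ} (h : IsClassicalSolution p a ε f g (T : EReal) u) (hT : 0 < T)
    (hf : Differentiable ℝ f) :
    ∃ P Q Pxx Pxt Qtt, IsSolutionWithDerivs p a ε f g T (fun z => u z.1 z.2) P Q Pxx Pxt Qtt := by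
  set U : ℝ × ℝ → ℝ := fun z => u z.1 z.2 with hU
  set S : Set (ℝ × ℝ) := {z | 0 ≤ z.2 ∧ z.2 < T} with hS
  set O : Set (ℝ × ℝ) := {z | 0 < z.2 ∧ z.2 < T} with hO
  have hc : ContDiffOn ℝ 2 U S := by simpa [hS] using h.contDiffOn
  have hOo : IsOpen O := (isOpen_lt continuous_const continuous_snd).inter
    (isOpen_lt continuous_snd continuous_const)
  have hOS : O ⊆ S := fun z hz => ⟨hz.1.le, hz.2⟩
  have hSn : ∀ z ∈ O, S ∈ 𝓝 z := fun z hz => mem_of_superset (hOo.mem_nhds hz) hOS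
  have hSeq : S = univ ×ˢ Ico 0 T := by ext z; simp [hS]
  have hSu : UniqueDiffOn ℝ S := by
    rw [hSeq]; exact uniqueDiffOn_univ.prod (uniqueDiffOn_Ico 0 T)
  set D := fderivWithin ℝ U S with hD
  have hD1 : ContDiffOn ℝ 1 D S := hc.fderivWithin hSu (by norm_num)
  have hDU : ∀ z ∈ S, HasFDerivWithinAt U (D z) S z := fun z hz =>
    ((hc.differentiableOn (by norm_num)) z hz).hasFDerivWithinAt
  have hDU' : ∀ z ∈ O, HasFDerivAt U (D z) z := fun z hz =>
    (hDU z (hOS hz)).hasFDerivAt (hSn z hz)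
  set E := fderiv ℝ D with hE
  have hDE : ∀ z ∈ O, HasFDerivAt D (E z) z := fun z hz =>
    (((hD1.contDiffAt (hSn z hz)).differentiableAt (by norm_num))).hasFDerivAt
  have hEc : ContinuousOn E O :=
    (hD1.mono hOS).continuousOn_fderiv_of_isOpen hOo le_rfl
  -- Symmetry lets one function `Pxt` serve as both mixed derivatives.
  have hsymm : ∀ z ∈ O, ∀ v w, E z v w = E z w v := fun z hz v w =>
    second_derivative_symmetric_of_eventually
      (Filter.mem_of_superset (hOo.mem_nhds hz) hDU') (hDE z hz) v w
  have hDE' : ∀ z ∈ O, ∀ v, HasFDerivAt (fun z => D z v)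
      (E z (1, 0) v • ContinuousLinearMap.fst ℝ ℝ ℝ +
        E z (0, 1) v • ContinuousLinearMap.snd ℝ ℝ ℝ) z := by
    intro z hz v
    have h1 := (hDE z hz).clm_apply (hasFDerivAt_const v z)
    refine (h1.congr_fderiv (ContinuousLinearMap.eq_smul_fst_add_smul_snd _)).congr_fderiv ?_
    simp
  have hU1 : ∀ z ∈ O, HasFDerivAt U (D z (1, 0) • ContinuousLinearMap.fst ℝ ℝ ℝ +
      D z (0, 1) • ContinuousLinearMap.snd ℝ ℝ ℝ) z := by
    intro z hz
    rw [← ContinuousLinearMap.eq_smul_fst_add_smul_snd]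
    exact hDU' z hz
  have hQ1 : ∀ z ∈ O, HasFDerivAt (fun z => D z (0, 1))
      (E z (0, 1) (1, 0) • ContinuousLinearMap.fst ℝ ℝ ℝ +
        E z (0, 1) (0, 1) • ContinuousLinearMap.snd ℝ ℝ ℝ) z := by
    intro z hz
    rw [hsymm z hz (0, 1) (1, 0)]
    exact hDE' z hz (0, 1)
  refine ⟨fun z => D z (1, 0), fun z => D z (0, 1), fun z => E z (1, 0) (1, 0),
    fun z => E z (0, 1) (1, 0), fun z => E z (0, 1) (0, 1), hc.continuousOn,
    hD1.continuousOn.clm_apply continuousOn_const, hD1.continuousOn.clm_apply continuousOn_const,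
    (hEc.clm_apply continuousOn_const).clm_apply continuousOn_const,
    (hEc.clm_apply continuousOn_const).clm_apply continuousOn_const,
    (hEc.clm_apply continuousOn_const).clm_apply continuousOn_const,
    fun z h1 h2 => hU1 z ⟨h1, h2⟩, fun z h1 h2 => hDE' z ⟨h1, h2⟩ _,
    fun z h1 h2 => hQ1 z ⟨h1, h2⟩, ?_, ?_, ?_, ?_⟩
  · rintro ⟨x, t⟩ h1 h2
    have hz : (x, t) ∈ O := ⟨h1, h2⟩
    have ht : ∀ᶠ s in 𝓝 t, (x, s) ∈ O :=
      (Continuous.tendsto (by fun_prop : Continuous fun s : ℝ => (x, s)) t) (hOo.mem_nhds hz)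
    have hx : ∀ᶠ y in 𝓝 x, (y, t) ∈ O := Eventually.of_forall fun y => ⟨h1, h2⟩
    have e1 : iteratedDeriv 2 (fun s => u x s) t = E (x, t) (0, 1) (0, 1) :=
      iteratedDeriv_two_eq (ht.mono fun s hs => (hU1 (x, s) hs).hasDerivAt_snd)
        (hQ1 (x, t) hz).hasDerivAt_snd
    have e2 : iteratedDeriv 2 (fun y => u y t) x = E (x, t) (1, 0) (1, 0) :=
      iteratedDeriv_two_eq (hx.mono fun y hy => (hU1 (y, t) hy).hasDerivAt_fst)
        (hDE' (x, t) hz (1, 0)).hasDerivAt_fst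
    have e3 : deriv (fun y => u y t) x = D (x, t) (1, 0) := (hU1 (x, t) hz).hasDerivAt_fst.deriv
    have := h.equation x t h1 (by exact_mod_cast h2)
    rw [e1, e2, e3] at this
    exact this
  · exact h.initial_value
  · intro x
    have h1 : HasDerivAt (fun y : ℝ => (y, (0 : ℝ))) (1, 0) x :=
      (hasDerivAt_id x).prodMk (hasDerivAt_const x 0)
    have h2 : HasDerivWithinAt (U ∘ fun y : ℝ => (y, (0 : ℝ))) (D (x, 0) (1, 0)) univ x :=
      (hDU (x, 0) ⟨le_rfl, hT⟩).comp_hasDerivWithinAt x h1.hasDerivWithinAt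
        (fun y _ => show (0 : ℝ) ≤ 0 ∧ (0 : ℝ) < T from ⟨le_rfl, hT⟩)
    have h3 : (U ∘ fun y : ℝ => (y, (0 : ℝ))) = fun y => ε * f y := funext h.initial_value
    rw [h3, hasDerivWithinAt_univ] at h2
    exact h2.unique ((hf x).hasDerivAt.const_mul ε)
  · intro x
    have h1 : HasDerivAt (fun s : ℝ => (x, s)) (0, 1) 0 :=
      (hasDerivAt_const 0 x).prodMk (hasDerivAt_id 0)
    have h2 : HasDerivWithinAt (U ∘ fun s : ℝ => (x, s)) (D (x, 0) (0, 1)) (Ico 0 T) 0 :=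
      (hDU (x, 0) ⟨le_rfl, hT⟩).comp_hasDerivWithinAt 0 h1.hasDerivWithinAt
        (fun y hy => hy)
    have h3 : HasDerivWithinAt (fun s => u x s) (ε * g x) (Ico 0 T) 0 :=
      (h.initial_velocity x).mono Ico_subset_Ici_self
    exact (uniqueDiffOn_Ico 0 T 0 ⟨le_rfl, hT⟩).eq_deriv _ h2 h3

/-! ### Integrals depending on a parameter -/

/-- A parameter integral over a compact interval of a jointly continuous function is continuous. -/
theorem continuousOn_intervalIntegral_of_continuousOn {φ : ℝ → ℝ → ℝ} {T₀ c d : ℝ} (hcd : c ≤ d)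
    (hφ : ContinuousOn (fun z : ℝ × ℝ => φ z.1 z.2) (Icc 0 T₀ ×ˢ Icc c d)) :
    ContinuousOn (fun t => ∫ y in c..d, φ t y) (Icc 0 T₀) := by
  obtain ⟨M, hM⟩ := (isCompact_Icc.prod isCompact_Icc).exists_bound_of_continuousOn hφ
  intro t ht
  refine intervalIntegral.continuousWithinAt_of_dominated_interval (bound := fun _ => M) ?_ ?_
    intervalIntegrable_const ?_
  · filter_upwards [self_mem_nhdsWithin] with s hs
    rw [uIoc_of_le hcd]
    have : ContinuousOn (φ s) (Icc c d) := hφ.comp (f := fun y => (s, y)) (by fun_prop)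
      (fun y hy => ⟨hs, hy⟩)
    exact (this.mono Ioc_subset_Icc_self).aestronglyMeasurable measurableSet_Ioc
  · filter_upwards [self_mem_nhdsWithin] with s hs
    refine Eventually.of_forall fun y hy => ?_
    rw [uIoc_of_le hcd] at hy
    exact hM (s, y) ⟨hs, Ioc_subset_Icc_self hy⟩
  · refine Eventually.of_forall fun y hy => ?_
    rw [uIoc_of_le hcd] at hy
    have : ContinuousOn (fun s => φ s y) (Icc 0 T₀) := hφ.comp (f := fun s => (s, y)) (by fun_prop)
      (fun s hs => ⟨hs, Ioc_subset_Icc_self hy⟩)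
    exact this t ht

/-- Differentiation under the integral sign over a compact interval, for a jointly continuous
derivative. -/
theorem hasDerivAt_intervalIntegral_of_continuousOn {φ φ' : ℝ → ℝ → ℝ} {T c d t : ℝ} (hcd : c ≤ d)
    (ht : t ∈ Ioo 0 T)
    (hφ : ∀ t ∈ Ioo 0 T, ContinuousOn (φ t) (Icc c d))
    (hφ' : ContinuousOn (fun z : ℝ × ℝ => φ' z.1 z.2) (Ioo 0 T ×ˢ Icc c d))
    (hd : ∀ t ∈ Ioo 0 T, ∀ y ∈ Icc c d, HasDerivAt (fun s => φ s y) (φ' t y) t) :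
    HasDerivAt (fun t => ∫ y in c..d, φ t y) (∫ y in c..d, φ' t y) t := by
  obtain ⟨K, hK, hKT, hKc⟩ := exists_compact_subset isOpen_Ioo ht
  have hKc' : K ⊆ Ioo 0 T := hKc
  obtain ⟨M, hM⟩ := (hK.prod isCompact_Icc).exists_bound_of_continuousOn
    (hφ'.mono (prod_mono hKc' (subset_refl (Icc c d))))
  refine (intervalIntegral.hasDerivAt_integral_of_dominated_loc_of_deriv_le (F' := φ')
    (s := K) (bound := fun _ => M) (mem_interior_iff_mem_nhds.1 hKT) ?_ ?_ ?_ ?_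
    intervalIntegrable_const ?_).2
  · filter_upwards [isOpen_Ioo.mem_nhds ht] with s hs
    rw [uIoc_of_le hcd]
    exact ((hφ s hs).mono Ioc_subset_Icc_self).aestronglyMeasurable measurableSet_Ioc
  · exact (hφ t ht).intervalIntegrable_of_Icc hcd
  · rw [uIoc_of_le hcd]
    have : ContinuousOn (φ' t) (Icc c d) := hφ'.comp (f := fun y => (t, y)) (by fun_prop)
      (fun y hy => ⟨ht, hy⟩)
    exact (this.mono Ioc_subset_Icc_self).aestronglyMeasurable measurableSet_Ioc
  · refine Eventually.of_forall fun y hy s hs => ?_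
    rw [uIoc_of_le hcd] at hy
    exact hM (s, y) ⟨hs, Ioc_subset_Icc_self hy⟩
  · refine Eventually.of_forall fun y hy s hs => ?_
    rw [uIoc_of_le hcd] at hy
    exact hd s (hKc' hs) y (Ioc_subset_Icc_self hy)

/-! ### Young's inequality and the Japanese bracket -/

/-- A form of Young's inequality. -/
theorem mul_div_le_mul_rpow_add {p c C B S : ℝ} (hp : 1 < p) (hc : 0 < c) (hC : 0 ≤ C)
    (hB : 0 ≤ B) (hS : 0 < S) :
    C * B / S ≤ c * B ^ p + C * (C / c) ^ (1 / (p - 1)) * S ^ (-(p / (p - 1))) := by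
  have hp1 : 0 < p - 1 := by linarith
  have hR : 0 ≤ C * (C / c) ^ (1 / (p - 1)) * S ^ (-(p / (p - 1))) := by positivity
  rcases hB.eq_or_lt with rfl | hB
  · have : 0 ≤ c * (0 : ℝ) ^ p := by positivity
    rw [mul_zero, zero_div]
    linarith
  -- Either the power term alone dominates, or `B` is so small that the left side is bounded by the
  -- power of `S`.
  by_cases h : C / S ≤ c * B ^ (p - 1)
  · have h1 : C * B / S ≤ c * B ^ p := by
      calc C * B / S = C / S * B := by ring
        _ ≤ c * B ^ (p - 1) * B := by gcongr
        _ = c * B ^ p := by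
          rw [mul_assoc, ← Real.rpow_add_one hB.ne']; congr 2; ring
    linarith
  · push Not at h
    have h1 : B ^ (p - 1) ≤ C / c / S := by
      rw [div_div, le_div_iff₀ (by positivity)]
      rw [lt_div_iff₀ hS] at h
      linarith
    have h2 : B ≤ (C / c / S) ^ (1 / (p - 1)) := by
      calc B = (B ^ (p - 1)) ^ (1 / (p - 1)) := by
            rw [← Real.rpow_mul hB.le, mul_one_div_cancel hp1.ne', Real.rpow_one]
        _ ≤ _ := by gcongr
    have h3 : C * B / S ≤ C * (C / c) ^ (1 / (p - 1)) * S ^ (-(p / (p - 1))) := by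
      calc C * B / S ≤ C * (C / c / S) ^ (1 / (p - 1)) / S := by gcongr
        _ = C * (C / c) ^ (1 / (p - 1)) * (S ^ (1 / (p - 1)) * S)⁻¹ := by
          rw [Real.div_rpow (by positivity) hS.le]; field_simp
        _ = _ := by
          rw [← Real.rpow_add_one hS.ne', Real.rpow_neg hS.le]
          congr 3
          field_simp
          ring
    have : 0 ≤ c * B ^ p := by positivity
    linarith

theorem one_le_japaneseBracket (x : ℝ) : 1 ≤ japaneseBracket x := by
  rw [japaneseBracket, Real.one_le_sqrt]; nlinarith [sq_nonneg x]

theorem japaneseBracket_le (x : ℝ) : japaneseBracket x ≤ 1 + |x| := by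
  rw [japaneseBracket, Real.sqrt_le_iff]
  refine ⟨by positivity, ?_⟩
  nlinarith [sq_abs x, abs_nonneg x]

theorem abs_le_japaneseBracket (x : ℝ) : |x| ≤ japaneseBracket x := by
  rw [japaneseBracket, ← Real.sqrt_sq_eq_abs]
  exact Real.sqrt_le_sqrt (by linarith)

theorem continuous_japaneseBracket : Continuous japaneseBracket := by
  unfold japaneseBracket; fun_prop

/-- In the strip `|x - t| ≤ R` the weights `⟨x⟩` and `1 + t` are comparable. -/
theorem mul_one_add_rpow_le_japaneseBracket_rpow {a R y t : ℝ} (hR : 0 ≤ R) (hy : |y| ≤ R)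
    (ht : 0 ≤ t) :
    (2 + R) ^ (-|a|) * (1 + t) ^ (-a) ≤ (japaneseBracket (y + t) ^ a)⁻¹ := by
  have hJ := one_le_japaneseBracket (y + t)
  have h1 : japaneseBracket (y + t) ≤ (2 + R) * (1 + t) := by
    have := japaneseBracket_le (y + t)
    have h2 := abs_add_le y t
    rw [abs_of_nonneg ht] at h2
    nlinarith
  have h2 : 1 + t ≤ (2 + R) * japaneseBracket (y + t) := by
    have h3 := abs_le_japaneseBracket (y + t)
    have h4 := le_abs_self (y + t)
    have h5 := neg_abs_le y
    nlinarith
  have hR2 : (0 : ℝ) < 2 + R := by linarith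
  have ht1 : (0 : ℝ) < 1 + t := by linarith
  have hJ0 : 0 < japaneseBracket (y + t) := by linarith
  rw [← Real.rpow_neg hJ0.le]
  -- For `a ≥ 0` the upper bound on `⟨y + t⟩` is what matters, for `a ≤ 0` the lower one.
  rcases le_total 0 a with ha | ha
  · rw [abs_of_nonneg ha, ← Real.mul_rpow hR2.le ht1.le]
    exact Real.rpow_le_rpow_of_nonpos hJ0 h1 (by linarith)
  · rw [abs_of_nonpos ha, neg_neg]
    calc (2 + R) ^ a * (1 + t) ^ (-a)
        ≤ (2 + R) ^ a * ((2 + R) * japaneseBracket (y + t)) ^ (-a) := by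
          gcongr; linarith
      _ = _ := by
          rw [Real.mul_rpow hR2.le hJ0.le, ← mul_assoc, ← Real.rpow_add hR2]; simp

/-! ### Finite speed of propagation -/

theorem monotoneOn_Icc_of_hasDerivAt_nonneg {f f' : ℝ → ℝ} {a b : ℝ}
    (hf : ContinuousOn f (Icc a b)) (hd : ∀ x ∈ Ioo a b, HasDerivAt f (f' x) x)
    (h0 : ∀ x ∈ Ioo a b, 0 ≤ f' x) : MonotoneOn f (Icc a b) := by
  refine monotoneOn_of_hasDerivWithinAt_nonneg (convex_Icc a b) hf (f' := f') ?_ ?_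
  · intro x hx
    rw [interior_Icc] at hx
    exact (hd x hx).hasDerivWithinAt
  · intro x hx
    rw [interior_Icc] at hx
    exact h0 x hx

theorem abs_le_of_abs_hasDerivAt_le {f f' B B' : ℝ → ℝ} {a b : ℝ} (hab : a ≤ b)
    (hf : ContinuousOn f (Icc a b)) (hd : ∀ x ∈ Ioo a b, HasDerivAt f (f' x) x)
    (hB : ContinuousOn B (Icc a b)) (hBd : ∀ x ∈ Ioo a b, HasDerivAt B (B' x) x)
    (h0 : |f a| ≤ B a) (hle : ∀ x ∈ Ioo a b, |f' x| ≤ B' x) : |f b| ≤ B b := by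
  have h1 := monotoneOn_Icc_of_hasDerivAt_nonneg (hB.sub hf)
    (fun x hx => (hBd x hx).sub (hd x hx)) (fun x hx => by linarith [le_abs_self (f' x), hle x hx])
    (left_mem_Icc.2 hab) (right_mem_Icc.2 hab) hab
  have h2 := monotoneOn_Icc_of_hasDerivAt_nonneg (hB.add hf)
    (fun x hx => (hBd x hx).add (hd x hx)) (fun x hx => by linarith [neg_abs_le (f' x), hle x hx])
    (left_mem_Icc.2 hab) (right_mem_Icc.2 hab) hab
  simp only [Pi.sub_apply, Pi.add_apply] at h1 h2
  rw [abs_le] at h0 ⊢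
  constructor <;> linarith

namespace IsSolutionWithDerivs

variable {p a ε T : ℝ} {f g : ℝ → ℝ} {U P Q Pxx Pxt Qtt : ℝ × ℝ → ℝ}

theorem hasDerivAt_line (h : IsSolutionWithDerivs p a ε f g T U P Q Pxx Pxt Qtt) {x t c s : ℝ}
    (h0 : 0 < t + s) (hT : t + s < T) :
    HasDerivAt (fun r => U (x + c * r, t + r)) (P (x + c * s, t + s) * c + Q (x + c * s, t + s)) s := by
  have := HasFDerivAt.hasDerivAt_line (x := x) (t := t) (c := c) (d := 1) (s := s)
    (h.hasFDerivAt _ (by simpa using h0) (by simpa using hT))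
  simpa using this

theorem hasDerivAt_x_line (h : IsSolutionWithDerivs p a ε f g T U P Q Pxx Pxt Qtt) {x t c s : ℝ}
    (h0 : 0 < t + s) (hT : t + s < T) :
    HasDerivAt (fun r => P (x + c * r, t + r))
      (Pxx (x + c * s, t + s) * c + Pxt (x + c * s, t + s)) s := by
  have := HasFDerivAt.hasDerivAt_line (x := x) (t := t) (c := c) (d := 1) (s := s)
    (h.hasFDerivAt_x _ (by simpa using h0) (by simpa using hT))
  simpa using this

theorem hasDerivAt_t_line (h : IsSolutionWithDerivs p a ε f g T U P Q Pxx Pxt Qtt) {x t c s : ℝ}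
    (h0 : 0 < t + s) (hT : t + s < T) :
    HasDerivAt (fun r => Q (x + c * r, t + r))
      (Pxt (x + c * s, t + s) * c + Qtt (x + c * s, t + s)) s := by
  have := HasFDerivAt.hasDerivAt_line (x := x) (t := t) (c := c) (d := 1) (s := s)
    (h.hasFDerivAt_t _ (by simpa using h0) (by simpa using hT))
  simpa using this

/-- Finite speed of propagation. -/
theorem derivs_eq_zero (h : IsSolutionWithDerivs p a ε f g T U P Q Pxx Pxt Qtt) (hp : 1 < p)
    {R : ℝ} (hf : ∀ x, R ≤ x → deriv f x = 0) (hg : ∀ x, R ≤ x → g x = 0) {x t : ℝ} (ht : 0 ≤ t)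
    (htT : t < T) (hx : t + R ≤ x) : P (x, t) = 0 ∧ Q (x, t) = 0 := by
  -- A compact region containing `(x, t)` and closed under following both characteristics back to `t
  -- = 0`; its left edge is itself characteristic, and its base lies where the data vanish.
  -- Compactness makes any condition at infinity superfluous.
  set K : Set (ℝ × ℝ) := {z | (0 ≤ z.2 ∧ z.2 ≤ t) ∧ z.2 + R ≤ z.1 ∧ z.1 ≤ x + t - z.2} with hK
  have hKc : IsCompact K := by
    refine ((isCompact_Icc (a := R) (b := x + t)).prod
      (isCompact_Icc (a := 0) (b := t))).of_isClosed_subset ?_ ?_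
    · refine IsClosed.and (IsClosed.and ?_ ?_) (IsClosed.and ?_ ?_) <;>
        exact isClosed_le (by fun_prop) (by fun_prop)
    · rintro ⟨y, s⟩ ⟨⟨h1, h2⟩, h3, h4⟩
      simp only at h1 h2 h3 h4
      exact ⟨⟨by linarith, by linarith⟩, h1, h2⟩
  have hxK : (x, t) ∈ K := ⟨⟨ht, le_rfl⟩, hx, by simp⟩
  have hKS : K ⊆ {z | 0 ≤ z.2 ∧ z.2 < T} := fun z hz => ⟨hz.1.1, hz.1.2.trans_lt htT⟩
  have hPc := h.continuousOn_x.mono hKS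
  have hQc := h.continuousOn_t.mono hKS
  have hJc : Continuous fun z : ℝ × ℝ => japaneseBracket z.1 ^ a :=
    (continuous_japaneseBracket.comp continuous_fst).rpow_const
      (fun z => Or.inl (zero_lt_one.trans_le (one_le_japaneseBracket z.1)).ne')
  have hJ0 : ∀ z : ℝ × ℝ, 0 < japaneseBracket z.1 ^ a := fun z =>
    Real.rpow_pos_of_pos (by linarith [one_le_japaneseBracket z.1]) _
  -- Since `p > 1`, the factor `|P|^(p-1)` is bounded on `K`, so the nonlinearity is at most linear
  -- in `P` there.
  obtain ⟨L, hL⟩ := hKc.exists_bound_of_continuousOn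
    (f := fun z => |P z| ^ (p - 1) / japaneseBracket z.1 ^ a)
    ((hPc.abs.rpow_const (fun z _ => Or.inr (by linarith))).div hJc.continuousOn
      (fun z _ => (hJ0 z).ne'))
  have hL0 : 0 ≤ L := (norm_nonneg _).trans (hL _ hxK)
  set V : ℝ × ℝ → ℝ := fun z => |Q z + P z| + |Q z - P z| with hV
  have hF : ∀ z ∈ K, |(|P z| ^ p / japaneseBracket z.1 ^ a)| ≤ L / 2 * V z := by
    intro z hz
    have h1 : |P z| ^ p / japaneseBracket z.1 ^ a =
        |P z| ^ (p - 1) / japaneseBracket z.1 ^ a * |P z| := by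
      rcases eq_or_ne (P z) 0 with h0 | h0
      · simp [h0, Real.zero_rpow (by linarith : p ≠ 0)]
      · rw [div_mul_eq_mul_div, ← Real.rpow_add_one (abs_pos.2 h0).ne']; simp
    have h2 := hL z hz
    rw [Real.norm_eq_abs] at h2
    rw [h1, abs_mul, abs_abs]
    have h3 : |P z| ≤ V z / 2 := by
      have := abs_sub (Q z + P z) (Q z - P z)
      rw [show Q z + P z - (Q z - P z) = 2 * P z by ring, abs_mul, abs_two] at this
      simp only [hV]; linarith
    calc _ ≤ L * (V z / 2) := by gcongr
      _ = _ := by ring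
  -- Any rate above `L` works: at a maximum of `exp (-lam t) V`, integrating along characteristics
  -- returns at most the fraction `L / lam < 1` of that maximum, which must then be zero.
  set lam : ℝ := 2 * L + 1 with hlam
  have hlam0 : 0 < lam := by positivity
  obtain ⟨z₁, hz₁, hmax⟩ := hKc.exists_isMaxOn ⟨_, hxK⟩
    (f := fun z => Real.exp (-(lam * z.2)) * V z)
    ((by fun_prop : Continuous fun z : ℝ × ℝ => Real.exp (-(lam * z.2))).continuousOn.mul
      ((hQc.add hPc).abs.add (hQc.sub hPc).abs))
  set N : ℝ := Real.exp (-(lam * z₁.2)) * V z₁ with hN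
  have hVN : ∀ z ∈ K, V z ≤ N * Real.exp (lam * z.2) := by
    intro z hz
    have h1 : Real.exp (-(lam * z.2)) * V z ≤ N := hmax hz
    calc V z = Real.exp (-(lam * z.2)) * V z * Real.exp (lam * z.2) := by
          rw [mul_right_comm, ← Real.exp_add]; simp
      _ ≤ _ := by gcongr
  have hV0 : ∀ z, 0 ≤ V z := fun z => by positivity
  have hN0 : 0 ≤ N := mul_nonneg (Real.exp_pos _).le (hV0 _)
  obtain ⟨x₁, t₁⟩ := z₁
  obtain ⟨⟨ht1, ht1'⟩, hx1, hx1'⟩ := hz₁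
  simp only at ht1 ht1' hx1 hx1'
  set B : ℝ → ℝ := fun s => L / 2 * (N * Real.exp (lam * s)) / lam with hB
  have hBd : ∀ s, HasDerivAt B (L / 2 * (N * Real.exp (lam * s))) s := by
    intro s
    have := ((((hasDerivAt_id s).const_mul lam).exp.const_mul N).const_mul (L / 2)).div_const lam
    refine this.congr_deriv ?_
    simp only [id, mul_one]
    field_simp
  have hBc : ContinuousOn B (Icc 0 t₁) := fun s _ => (hBd s).continuousAt.continuousWithinAt
  have hB0 : 0 ≤ B 0 := by positivity
  -- `Q - c P` is a Riemann invariant: since `c² = 1`, its derivative along `x = x₀ + c s` is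
  -- exactly the nonlinearity, and it starts from zero.
  have key : ∀ c : ℝ, c = 1 ∨ c = -1 → |Q (x₁, t₁) - c * P (x₁, t₁)| ≤ B t₁ := by
    intro c hc
    have hline : ∀ s ∈ Icc 0 t₁, ((x₁ - c * t₁) + c * s, 0 + s) ∈ K := by
      rintro s ⟨hs0, hs1⟩
      rcases hc with rfl | rfl <;>
      exact ⟨⟨by simpa using hs0, by simp only; linarith⟩, by simp only; linarith, by simp only; linarith⟩
    have hcont : Continuous fun s : ℝ => ((x₁ - c * t₁) + c * s, 0 + s) := by fun_prop
    have hx0 : R ≤ x₁ - c * t₁ := by rcases hc with rfl | rfl <;> linarith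
    have := abs_le_of_abs_hasDerivAt_le ht1
      (f := fun s => Q ((x₁ - c * t₁) + c * s, 0 + s) - c * P ((x₁ - c * t₁) + c * s, 0 + s))
      (f' := fun s => |P ((x₁ - c * t₁) + c * s, 0 + s)| ^ p /
        japaneseBracket ((x₁ - c * t₁) + c * s) ^ a)
      ((hQc.comp hcont.continuousOn hline).sub
        (continuousOn_const.mul (hPc.comp hcont.continuousOn hline))) ?_ hBc
      (fun s _ => hBd s) ?_ ?_
    · simpa using this
    · rintro s ⟨hs0, hs1⟩
      have h0 : (0 : ℝ) < 0 + s := by simpa using hs0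
      have hsT : 0 + s < T := by linarith
      refine ((h.hasDerivAt_t_line h0 hsT).sub
        ((h.hasDerivAt_x_line h0 hsT).const_mul c)).congr_deriv ?_
      have he := h.equation ((x₁ - c * t₁) + c * s, 0 + s) h0 hsT
      simp only at he
      rw [← he]
      have : c * c = 1 := by rcases hc with rfl | rfl <;> norm_num
      linear_combination (-Pxx ((x₁ - c * t₁) + c * s, 0 + s)) * this
    · simpa [h.initial_x, h.initial_t, hf _ hx0, hg _ hx0] using hB0
    · intro s hs
      have hz := hline s (Ioo_subset_Icc_self hs)
      refine (hF _ hz).trans ?_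
      have := hVN _ hz
      simp only [zero_add] at this ⊢
      gcongr
  have k1 := key 1 (Or.inl rfl)
  have k2 := key (-1) (Or.inr rfl)
  have hVz : V (x₁, t₁) = N * Real.exp (lam * t₁) := by
    rw [hN, mul_right_comm, ← Real.exp_add]; simp
  have hsum : V (x₁, t₁) ≤ 2 * B t₁ := by
    simp only [hV]
    rw [one_mul] at k1
    rw [neg_one_mul, sub_neg_eq_add] at k2
    linarith
  have hBt : 2 * B t₁ * lam = L * (N * Real.exp (lam * t₁)) := by
    simp only [hB]; field_simp
  have hNe : N * Real.exp (lam * t₁) ≤ 0 := by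
    rw [hVz] at hsum
    have h1 : N * Real.exp (lam * t₁) * lam ≤ L * (N * Real.exp (lam * t₁)) := by
      rw [← hBt]; gcongr
    have h2 : 0 ≤ N * Real.exp (lam * t₁) := by positivity
    rw [hlam] at h1
    nlinarith
  have hN' : N ≤ 0 := by
    by_contra hcon
    push Not at hcon
    have := mul_pos hcon (Real.exp_pos (lam * t₁))
    linarith
  have hfin : V (x, t) ≤ 0 := (hVN _ hxK).trans (mul_nonpos_of_nonpos_of_nonneg hN' (Real.exp_pos _).le)
  have a1 : |Q (x, t) + P (x, t)| = 0 := by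
    have := abs_nonneg (Q (x, t) + P (x, t)); have := abs_nonneg (Q (x, t) - P (x, t))
    simp only [hV] at hfin; linarith
  have a2 : |Q (x, t) - P (x, t)| = 0 := by
    have := abs_nonneg (Q (x, t) + P (x, t)); have := abs_nonneg (Q (x, t) - P (x, t))
    simp only [hV] at hfin; linarith
  rw [abs_eq_zero] at a1 a2
  constructor <;> linarith

/-- A solution with data supported in `x < R` vanishes on the characteristic `x = t + R`. -/
theorem eq_zero_on_char (h : IsSolutionWithDerivs p a ε f g T U P Q Pxx Pxt Qtt) (hp : 1 < p)
    {R : ℝ} (hf : ∀ x, R ≤ x → deriv f x = 0) (hg : ∀ x, R ≤ x → g x = 0) (hfR : f R = 0) {t : ℝ}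
    (ht : 0 ≤ t) (htT : t < T) : U (R + t, t) = 0 := by
  have hcont : Continuous fun s : ℝ => (R + 1 * s, 0 + s) := by fun_prop
  have := abs_le_of_abs_hasDerivAt_le ht (f := fun s => U (R + 1 * s, 0 + s))
      (f' := fun s => P (R + 1 * s, 0 + s) * 1 + Q (R + 1 * s, 0 + s))
      (B := fun _ => 0) (B' := fun _ => 0)
      (h.continuousOn.comp hcont.continuousOn (fun s hs => ?_))
      (fun s hs => h.hasDerivAt_line (by simpa using hs.1) (by linarith [hs.2]))
      continuousOn_const (fun s _ => hasDerivAt_const s 0) ?_ ?_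
  · simpa using this
  · simpa using (⟨hs.1, hs.2.trans_lt htT⟩ : 0 ≤ s ∧ s < T)
  · simp [h.initial, hfR]
  · intro s hs
    obtain ⟨h1, h2⟩ := h.derivs_eq_zero hp hf hg (x := R + 1 * s) (t := 0 + s)
      (by simpa using hs.1.le) (by linarith [hs.2]) (by linarith)
    simp only [h1, h2]
    simp

end IsSolutionWithDerivs

/-! ### The primitive of the weight -/

/-- The antiderivative of `(1 + t)^{-a}` that vanishes at `t = 0`, for `a ≤ 1`. -/
noncomputable def weightPrimitive (a t : ℝ) : ℝ :=
  if a = 1 then Real.log (1 + t) else ((1 + t) ^ (1 - a) - 1) / (1 - a)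

theorem weightPrimitive_zero (a : ℝ) : weightPrimitive a 0 = 0 := by
  simp [weightPrimitive]

theorem hasDerivAt_one_add_rpow (b : ℝ) {t : ℝ} (ht : 0 ≤ t) :
    HasDerivAt (fun t : ℝ => (1 + t) ^ b) (b * (1 + t) ^ (b - 1)) t := by
  have := ((hasDerivAt_id t).const_add 1).rpow_const (p := b) (Or.inl (by simp; linarith))
  simpa using this

theorem hasDerivAt_weightPrimitive (a : ℝ) {t : ℝ} (ht : 0 ≤ t) :
    HasDerivAt (weightPrimitive a) ((1 + t) ^ (-a)) t := by
  have h1 : (0 : ℝ) < 1 + t := by linarith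
  by_cases ha : a = 1
  · have he : weightPrimitive a = fun t => Real.log (1 + t) := by
      ext t; simp [weightPrimitive, ha]
    rw [he]
    refine (((hasDerivAt_id t).const_add 1).log (by simp; linarith)).congr_deriv ?_
    rw [ha, Real.rpow_neg_one]; simp
  · have he : weightPrimitive a = fun t => ((1 + t) ^ (1 - a) - 1) / (1 - a) := by
      ext t; simp [weightPrimitive, ha]
    rw [he]
    refine (((hasDerivAt_one_add_rpow (1 - a) ht).sub_const 1).div_const (1 - a)).congr_deriv ?_
    rw [mul_div_cancel_left₀ _ (sub_ne_zero.2 (Ne.symm ha))]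
    congr 1; ring

theorem weightPrimitive_pos {a : ℝ} (ha : a ≤ 1) {T : ℝ} (hT : 0 < T) :
    0 < weightPrimitive a T := by
  unfold weightPrimitive
  split_ifs with h
  · exact Real.log_pos (by linarith)
  · have h1 : 0 < 1 - a := sub_pos.2 (lt_of_le_of_ne ha h)
    exact div_pos (sub_pos.2 (Real.one_lt_rpow (by linarith) h1)) h1

/-- A lower bound for the growth of the primitive in the case `a < 1`. -/
theorem exists_mul_rpow_le_weightPrimitive {a : ℝ} (ha : a < 1) :
    ∃ c : ℝ, 0 < c ∧ ∀ T : ℝ, 1 ≤ T → c * (1 + T) ^ (1 - a) ≤ weightPrimitive a T := by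
  have h1 : 0 < 1 - a := sub_pos.2 ha
  have h2 : (1 : ℝ) < 2 ^ (1 - a) := Real.one_lt_rpow (by norm_num) h1
  -- For `T ≥ 1`, the subtracted `1` is at most the fraction `2^{-(1-a)}` of `(1 + T)^{1-a}`.
  refine ⟨(1 - (2 ^ (1 - a))⁻¹) / (1 - a), div_pos (sub_pos.2 (inv_lt_one_of_one_lt₀ h2)) h1, ?_⟩
  intro T hT
  rw [weightPrimitive, if_neg ha.ne, div_mul_eq_mul_div]
  have h3 : (2 : ℝ) ^ (1 - a) ≤ (1 + T) ^ (1 - a) := by gcongr; linarith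
  have h4 : 1 ≤ (2 ^ (1 - a))⁻¹ * (1 + T) ^ (1 - a) := by
    rw [inv_mul_eq_div, one_le_div (by positivity)]; exact h3
  gcongr
  linarith

/-- This makes `q / S` bounded, so that the quadratic term `(q / S)²` in `η''` reduces to a multiple
of `q / S`. -/
theorem exists_weight_le_weightPrimitive {a : ℝ} (ha : a ≤ 1) :
    ∃ c : ℝ, 0 < c ∧ ∀ T : ℝ, 1 ≤ T → ∀ t : ℝ, 0 ≤ t → t ≤ T →
      (1 + t) ^ (-a) ≤ c * weightPrimitive a T := by
  rcases ha.lt_or_eq with ha | rfl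
  · obtain ⟨c, hc, h⟩ := exists_mul_rpow_le_weightPrimitive ha
    refine ⟨c⁻¹, inv_pos.2 hc, fun T hT t ht htT => ?_⟩
    have h1 : (1 + t) ^ (-a) ≤ (1 + T) ^ (1 - a) := by
      rcases le_total 0 a with h0 | h0
      · exact (Real.rpow_le_one_of_one_le_of_nonpos (by linarith) (by linarith)).trans
          (Real.one_le_rpow (by linarith) (by linarith))
      · calc (1 + t) ^ (-a) ≤ (1 + T) ^ (-a) :=
              Real.rpow_le_rpow (by linarith) (by linarith) (by linarith)
          _ ≤ _ := Real.rpow_le_rpow_of_exponent_le (by linarith) (by linarith)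
    rw [inv_mul_eq_div, le_div_iff₀ hc]
    nlinarith [h T hT]
  · refine ⟨(Real.log 2)⁻¹, inv_pos.2 (Real.log_pos (by norm_num)), fun T hT t ht htT => ?_⟩
    have h1 : (1 + t) ^ (-(1 : ℝ)) ≤ 1 :=
      Real.rpow_le_one_of_one_le_of_nonpos (by linarith) (by norm_num)
    have h2 : Real.log 2 ≤ Real.log (1 + T) := Real.log_le_log (by norm_num) (by linarith)
    refine h1.trans ?_
    rw [weightPrimitive, if_pos rfl, inv_mul_eq_div, one_le_div (Real.log_pos (by norm_num))]
    exact h2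

/-! ### The test functional and its derivative -/

/-- The test functional with time cutoff `η` in the coordinates `y = x - t`:
`η (∫ (u_t + u_x) (y + R) dy + 2 ∫ u dy) - η' ∫ u (y + R) dy`. -/
noncomputable def testFunctional (R : ℝ) (U P Q : ℝ × ℝ → ℝ) (η η' : ℝ → ℝ) (t : ℝ) : ℝ :=
  ∫ y in (-R)..R, (η t * ((P (y + t, t) + Q (y + t, t)) * (y + R) + 2 * U (y + t, t)) -
    η' t * (U (y + t, t) * (y + R)))

namespace IsSolutionWithDerivs

variable {p a ε T : ℝ} {f g : ℝ → ℝ} {U P Q Pxx Pxt Qtt : ℝ × ℝ → ℝ}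

theorem continuousOn_testFunctional (h : IsSolutionWithDerivs p a ε f g T U P Q Pxx Pxt Qtt)
    {R T₀ : ℝ} (hR : 0 ≤ R) (hT : T₀ < T) {η η' : ℝ → ℝ} (hη : ContinuousOn η (Icc 0 T₀))
    (hη' : ContinuousOn η' (Icc 0 T₀)) :
    ContinuousOn (testFunctional R U P Q η η') (Icc 0 T₀) := by
  refine continuousOn_intervalIntegral_of_continuousOn (by linarith) ?_
  have hm : Continuous fun z : ℝ × ℝ => (z.2 + z.1, z.1) := by fun_prop
  have hmaps : MapsTo (fun z : ℝ × ℝ => (z.2 + z.1, z.1)) (Icc 0 T₀ ×ˢ Icc (-R) R)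
      {z | 0 ≤ z.2 ∧ z.2 < T} := fun z hz => ⟨hz.1.1, hz.1.2.trans_lt hT⟩
  have h1 := h.continuousOn.comp hm.continuousOn hmaps
  have h2 := h.continuousOn_x.comp hm.continuousOn hmaps
  have h3 := h.continuousOn_t.comp hm.continuousOn hmaps
  have h4 : ContinuousOn (fun z : ℝ × ℝ => η z.1) (Icc 0 T₀ ×ˢ Icc (-R) R) :=
    hη.comp continuousOn_fst (fun z hz => hz.1)
  have h5 : ContinuousOn (fun z : ℝ × ℝ => η' z.1) (Icc 0 T₀ ×ˢ Icc (-R) R) :=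
    hη'.comp continuousOn_fst (fun z hz => hz.1)
  have h6 : Continuous fun z : ℝ × ℝ => z.2 + R := by fun_prop
  exact (h4.mul (((h2.add h3).mul h6.continuousOn).add (continuousOn_const.mul h1))).sub
    (h5.mul (h1.mul h6.continuousOn))

/-- At fixed `y`, time differentiation acts as `∂_t + ∂_x`. The equation replaces `U_tt` by `U_xx`
plus the nonlinearity, and what is left of the second derivatives is exact in `y`. The `η'` terms
collapse to `2 η' U`; this and `η'' U (y + R)` are integrated by parts in `y` to produce `U_x`. -/
theorem hasDerivAt_testFunctional (h : IsSolutionWithDerivs p a ε f g T U P Q Pxx Pxt Qtt)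
    (hp : 0 ≤ p) {R t : ℝ} (hR : 0 ≤ R) (h0 : 0 < t) (hT : t < T) {η η' η'' : ℝ → ℝ}
    (hη : ∀ t, 0 < t → t < T → HasDerivAt η (η' t) t)
    (hη' : ∀ t, 0 < t → t < T → HasDerivAt η' (η'' t) t)
    (hη'' : ContinuousOn η'' (Ioo 0 T))
    (hU : U (R + t, t) = 0) (hP : P (R + t, t) = 0) (hQ : Q (R + t, t) = 0) :
    ContinuousOn (fun y => (y + R) * (η t * (|P (y + t, t)| ^ p / japaneseBracket (y + t) ^ a) -
        2 * η' t * P (y + t, t) + η'' t * P (y + t, t) * (y + R) / 2)) (Icc (-R) R) ∧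
    HasDerivAt (testFunctional R U P Q η η')
      (∫ y in (-R)..R, (y + R) * (η t * (|P (y + t, t)| ^ p / japaneseBracket (y + t) ^ a) -
        2 * η' t * P (y + t, t) + η'' t * P (y + t, t) * (y + R) / 2)) t := by
  have hm : Continuous fun z : ℝ × ℝ => (z.2 + z.1, z.1) := by fun_prop
  have hmaps : MapsTo (fun z : ℝ × ℝ => (z.2 + z.1, z.1)) (Ioo 0 T ×ˢ Icc (-R) R)
      {z | 0 < z.2 ∧ z.2 < T} := fun z hz => ⟨hz.1.1, hz.1.2⟩
  have hsub : {z : ℝ × ℝ | 0 < z.2 ∧ z.2 < T} ⊆ {z | 0 ≤ z.2 ∧ z.2 < T} :=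
    fun z hz => ⟨hz.1.le, hz.2⟩
  have c1 := (h.continuousOn.mono hsub).comp hm.continuousOn hmaps
  have c2 := (h.continuousOn_x.mono hsub).comp hm.continuousOn hmaps
  have c3 := (h.continuousOn_t.mono hsub).comp hm.continuousOn hmaps
  have c4 := h.continuousOn_xx.comp hm.continuousOn hmaps
  have c5 := h.continuousOn_xt.comp hm.continuousOn hmaps
  have c6 := h.continuousOn_tt.comp hm.continuousOn hmaps
  have hηc : ContinuousOn η (Ioo 0 T) := fun s hs =>
    (hη s hs.1 hs.2).continuousAt.continuousWithinAt
  have hηc' : ContinuousOn η' (Ioo 0 T) := fun s hs =>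
    (hη' s hs.1 hs.2).continuousAt.continuousWithinAt
  have c7 : ContinuousOn (fun z : ℝ × ℝ => η z.1) (Ioo 0 T ×ˢ Icc (-R) R) :=
    hηc.comp continuousOn_fst (fun z hz => hz.1)
  have c8 : ContinuousOn (fun z : ℝ × ℝ => η' z.1) (Ioo 0 T ×ˢ Icc (-R) R) :=
    hηc'.comp continuousOn_fst (fun z hz => hz.1)
  have c9 : ContinuousOn (fun z : ℝ × ℝ => η'' z.1) (Ioo 0 T ×ˢ Icc (-R) R) :=
    hη''.comp continuousOn_fst (fun z hz => hz.1)
  have c10 : ContinuousOn (fun z : ℝ × ℝ => z.2 + R) (Ioo 0 T ×ˢ Icc (-R) R) := by fun_prop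
  set e : ℝ → ℝ → ℝ := fun t y =>
    η t * ((P (y + t, t) + Q (y + t, t)) * (y + R) + 2 * U (y + t, t)) -
      η' t * (U (y + t, t) * (y + R)) with he
  set e' : ℝ → ℝ → ℝ := fun t y =>
    η' t * ((P (y + t, t) + Q (y + t, t)) * (y + R) + 2 * U (y + t, t)) +
    η t * ((Pxx (y + t, t) + Pxt (y + t, t) + (Pxt (y + t, t) + Qtt (y + t, t))) * (y + R) +
      2 * (P (y + t, t) + Q (y + t, t))) -
    (η'' t * (U (y + t, t) * (y + R)) +
      η' t * ((P (y + t, t) + Q (y + t, t)) * (y + R))) with he'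
  set b : ℝ → ℝ := fun y =>
    (y + R) * (η t * (|P (y + t, t)| ^ p / japaneseBracket (y + t) ^ a) -
        2 * η' t * P (y + t, t) + η'' t * P (y + t, t) * (y + R) / 2) with hb
  -- Collects the boundary terms: it vanishes at `y = -R` through the factor `y + R`, and at `y = R`
  -- because `U`, `P`, `Q` do.
  set G : ℝ → ℝ := fun y => 2 * η t * ((P (y + t, t) + Q (y + t, t)) * (y + R)) +
    2 * η' t * (U (y + t, t) * (y + R)) - η'' t / 2 * (U (y + t, t) * (y + R) ^ 2) with hG
  have ce : ContinuousOn (fun z : ℝ × ℝ => e z.1 z.2) (Ioo 0 T ×ˢ Icc (-R) R) :=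
    (c7.mul (((c2.add c3).mul c10).add (continuousOn_const.mul c1))).sub (c8.mul (c1.mul c10))
  have ce' : ContinuousOn (fun z : ℝ × ℝ => e' z.1 z.2) (Ioo 0 T ×ˢ Icc (-R) R) :=
    ((c8.mul (((c2.add c3).mul c10).add (continuousOn_const.mul c1))).add
      (c7.mul ((((c4.add c5).add (c5.add c6)).mul c10).add
        (continuousOn_const.mul (c2.add c3))))).sub
      ((c9.mul (c1.mul c10)).add (c8.mul ((c2.add c3).mul c10)))
  have hslice : ∀ φ : ℝ × ℝ → ℝ, ContinuousOn φ (Ioo 0 T ×ˢ Icc (-R) R) → ∀ s ∈ Ioo 0 T,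
      ContinuousOn (fun y => φ (s, y)) (Icc (-R) R) := fun φ hφ s hs =>
    hφ.comp (f := fun y => (s, y)) (by fun_prop) (fun y hy => ⟨hs, hy⟩)
  have hdU : ∀ s ∈ Ioo 0 T, ∀ y,
      HasDerivAt (fun r => U (y + r, r)) (P (y + s, s) + Q (y + s, s)) s := fun s hs y => by
    simpa using h.hasDerivAt_line (x := y) (t := 0) (c := 1) (s := s) (by simpa using hs.1)
      (by simpa using hs.2)
  have hdP : ∀ s ∈ Ioo 0 T, ∀ y,
      HasDerivAt (fun r => P (y + r, r)) (Pxx (y + s, s) + Pxt (y + s, s)) s := fun s hs y => by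
    simpa using h.hasDerivAt_x_line (x := y) (t := 0) (c := 1) (s := s) (by simpa using hs.1)
      (by simpa using hs.2)
  have hdQ : ∀ s ∈ Ioo 0 T, ∀ y,
      HasDerivAt (fun r => Q (y + r, r)) (Pxt (y + s, s) + Qtt (y + s, s)) s := fun s hs y => by
    simpa using h.hasDerivAt_t_line (x := y) (t := 0) (c := 1) (s := s) (by simpa using hs.1)
      (by simpa using hs.2)
  have hE : HasDerivAt (testFunctional R U P Q η η') (∫ y in (-R)..R, e' t y) t := by
    refine hasDerivAt_intervalIntegral_of_continuousOn (φ := e) (by linarith) ⟨h0, hT⟩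
      (fun s hs => hslice _ ce s hs) ce' (fun s hs y _ => ?_)
    exact ((hη s hs.1 hs.2).mul ((((hdP s hs y).add (hdQ s hs y)).mul_const (y + R)).add
      ((hdU s hs y).const_mul 2))).sub ((hη' s hs.1 hs.2).mul ((hdU s hs y).mul_const (y + R)))
  have hbc : ContinuousOn b (Icc (-R) R) := by
    have d2 := hslice _ c2 t ⟨h0, hT⟩
    simp only [Function.comp_apply] at d2
    have dJ : Continuous fun y : ℝ => japaneseBracket (y + t) ^ a :=
      (continuous_japaneseBracket.comp (by fun_prop : Continuous fun y : ℝ => y + t)).rpow_const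
        (fun y => Or.inl (zero_lt_one.trans_le (one_le_japaneseBracket _)).ne')
    have dχ : ContinuousOn (fun y : ℝ => y + R) (Icc (-R) R) := by fun_prop
    refine dχ.mul (((continuousOn_const.mul ((d2.abs.rpow_const fun y _ => Or.inr hp).div
      dJ.continuousOn fun y _ => ?_)).sub (continuousOn_const.mul d2)).add
        (((continuousOn_const.mul d2).mul dχ).div_const 2))
    exact (Real.rpow_pos_of_pos (zero_lt_one.trans_le (one_le_japaneseBracket _)) _).ne'
  have hGd : ∀ y ∈ uIcc (-R) R, HasDerivAt G (e' t y - b y) y := by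
    intro y _
    have gU : HasDerivAt (fun y => U (y + t, t)) (P (y + t, t)) y :=
      (h.hasFDerivAt (y + t, t) h0 hT).hasDerivAt_fst.comp_add_const y t
    have gP : HasDerivAt (fun y => P (y + t, t)) (Pxx (y + t, t)) y :=
      (h.hasFDerivAt_x (y + t, t) h0 hT).hasDerivAt_fst.comp_add_const y t
    have gQ : HasDerivAt (fun y => Q (y + t, t)) (Pxt (y + t, t)) y :=
      (h.hasFDerivAt_t (y + t, t) h0 hT).hasDerivAt_fst.comp_add_const y t
    have gχ : HasDerivAt (fun y => y + R) 1 y := (hasDerivAt_id y).add_const R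
    refine (((((gP.add gQ).mul gχ).const_mul (2 * η t)).add
      ((gU.mul gχ).const_mul (2 * η' t))).sub
      ((gU.mul (gχ.pow 2)).const_mul (η'' t / 2))).congr_deriv ?_
    have heq := h.equation (y + t, t) h0 hT
    simp only at heq
    simp only [he', hb, ← heq, Pi.add_apply, Pi.pow_apply]
    push_cast
    ring
  have hint : IntervalIntegrable (fun y => e' t y - b y) volume (-R) R :=
    ((hslice _ ce' t ⟨h0, hT⟩).sub hbc).intervalIntegrable_of_Icc (by linarith)
  have hzero : ∫ y in (-R)..R, (e' t y - b y) = 0 := by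
    rw [intervalIntegral.integral_eq_sub_of_hasDerivAt hGd hint]
    simp [hG, hU, hP, hQ]
  refine ⟨hbc, hE.congr_deriv ?_⟩
  rw [intervalIntegral.integral_sub ((hslice _ ce' t ⟨h0, hT⟩).intervalIntegrable_of_Icc
    (by linarith)) (hbc.intervalIntegrable_of_Icc (by linarith))] at hzero
  linarith

end IsSolutionWithDerivs

/-! ### Absorption and the a priori bound -/

/-- The pointwise absorption of the linear terms into the nonlinearity, for the cutoff
`η = θ ^ (n + 2)` with derivatives `D₁`, `D₂`. -/
theorem neg_le_mul_rpow_sub_mul_add {p θ c C q S W A D₁ D₂ χ R : ℝ} {n : ℕ} (hp : 1 < p)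
    (hn : ((n : ℝ) + 2) / p ≤ n) (hθ0 : 0 ≤ θ) (hθ1 : θ ≤ 1) (hc : 0 < c) (hC : 0 ≤ C)
    (hq : 0 < q) (hS : 0 < S) (hW : c * q ≤ W) (hχ0 : 0 ≤ χ) (hχ : χ ≤ 2 * R)
    (hD : 2 * |D₁| + |D₂| * R ≤ C * (θ ^ n * q / S)) :
    -(2 * R * q * (C * (C / c) ^ (1 / (p - 1)) * S ^ (-(p / (p - 1))))) ≤
      χ * (θ ^ (n + 2) * (|A| ^ p * W) - 2 * D₁ * A + D₂ * A * χ / 2) := by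
  have hp0 : 0 < p := by linarith
  set M := C * (C / c) ^ (1 / (p - 1)) * S ^ (-(p / (p - 1))) with hM
  have hM0 : 0 ≤ M := by positivity
  set B := (θ ^ (n + 2)) ^ (1 / p) * |A| with hB
  have hB0 : 0 ≤ B := by positivity
  have hBp : B ^ p = θ ^ (n + 2) * |A| ^ p := by
    rw [hB, Real.mul_rpow (by positivity) (abs_nonneg A), ← Real.rpow_mul (by positivity),
      one_div_mul_cancel hp0.ne', Real.rpow_one]
  -- Here `(n + 2) / p ≤ n` enters: the power of `θ` left after two differentiations is still
  -- dominated by `η^{1/p}`.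
  have hθn : θ ^ n ≤ (θ ^ (n + 2)) ^ (1 / p) := by
    rw [← Real.rpow_natCast θ (n + 2), ← Real.rpow_mul hθ0, ← Real.rpow_natCast θ n]
    refine Real.rpow_le_rpow_of_exponent_ge' hθ0 hθ1 (by positivity) ?_
    push_cast
    rw [mul_one_div]
    exact hn
  have hY : C * B / S ≤ c * (θ ^ (n + 2) * |A| ^ p) + M := by
    rw [← hBp]
    exact mul_div_le_mul_rpow_add hp hc hC hB0 hS
  have hlin : (2 * |D₁| + |D₂| * R) * |A| ≤ q * (C * B / S) := by
    calc (2 * |D₁| + |D₂| * R) * |A| ≤ C * (θ ^ n * q / S) * |A| := by gcongr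
      _ = q * (C * (θ ^ n * |A|) / S) := by ring
      _ ≤ q * (C * B / S) := by rw [hB]; gcongr
  have h1 : D₁ * A ≤ |D₁| * |A| := by rw [← abs_mul]; exact le_abs_self _
  have h2 : -(|D₂| * |A| * R) ≤ D₂ * A * χ / 2 := by
    have h3 : -(|D₂| * |A|) ≤ D₂ * A := by rw [← abs_mul]; exact neg_abs_le _
    have h4 : 0 ≤ |D₂| * |A| := by positivity
    nlinarith
  have h3 : c * q * (θ ^ (n + 2) * |A| ^ p) ≤ θ ^ (n + 2) * (|A| ^ p * W) := by
    calc c * q * (θ ^ (n + 2) * |A| ^ p) ≤ W * (θ ^ (n + 2) * |A| ^ p) := by gcongr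
      _ = _ := by ring
  have h4 : -(q * M) ≤ θ ^ (n + 2) * (|A| ^ p * W) - 2 * D₁ * A + D₂ * A * χ / 2 := by
    have := mul_le_mul_of_nonneg_left hY hq.le
    nlinarith
  have h5 : 0 ≤ q * M := by positivity
  calc -(2 * R * q * M) ≤ χ * -(q * M) := by nlinarith
    _ ≤ _ := by gcongr

/-- The `f'` term integrates by parts against `y + R` and cancels one of the two copies of `∫ f`. -/
theorem IsSolutionWithDerivs.testFunctional_zero {p a ε T R : ℝ} {f g : ℝ → ℝ}
    {U P Q Pxx Pxt Qtt : ℝ × ℝ → ℝ} (h : IsSolutionWithDerivs p a ε f g T U P Q Pxx Pxt Qtt)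
    (hf : ContDiff ℝ 1 f) (hg : Continuous g) (hfR : f R = 0) (η η' : ℝ → ℝ) :
    testFunctional R U P Q η η' 0 = η 0 * (ε * ∫ y in (-R)..R, (g y * (y + R) + f y)) -
      η' 0 * (ε * ∫ y in (-R)..R, f y * (y + R)) := by
  have hfc := hf.continuous
  have hf'c : Continuous (deriv f) := hf.continuous_deriv le_rfl
  have h1 : ∫ y in (-R)..R, (deriv f y * (y + R) + f y) = 0 := by
    have : ∀ y ∈ uIcc (-R) R, HasDerivAt (fun y => f y * (y + R)) (deriv f y * (y + R) + f y) y := by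
      intro y _
      refine (((hf.differentiable (by norm_num)) y).hasDerivAt.fun_mul
        ((hasDerivAt_id y).add_const R)).congr_deriv ?_
      simp
    rw [intervalIntegral.integral_eq_sub_of_hasDerivAt this
      (Continuous.intervalIntegrable (by fun_prop) _ _)]
    simp [hfR]
  have h2 : testFunctional R U P Q η η' 0 = ∫ y in (-R)..R,
      ((η 0 * ε) * (deriv f y * (y + R) + f y) + (η 0 * ε) * (g y * (y + R) + f y) -
        (η' 0 * ε) * (f y * (y + R))) := by
    unfold testFunctional
    congr 1
    ext y
    rw [add_zero, h.initial, h.initial_x, h.initial_t]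
    ring
  rw [h2, intervalIntegral.integral_sub, intervalIntegral.integral_add,
    intervalIntegral.integral_const_mul, intervalIntegral.integral_const_mul,
    intervalIntegral.integral_const_mul, h1]
  · ring
  all_goals exact Continuous.intervalIntegrable (by fun_prop) _ _

/-- The a priori bound on the size of the data of a solution existing beyond time `T₀`. -/
theorem exists_data_le_weightPrimitive_rpow {p a R : ℝ} (hp : 1 < p) (ha : a ≤ 1) (hR : 0 < R) :
    ∃ C : ℝ, 0 < C ∧ ∀ (ε T T₀ : ℝ) (f g : ℝ → ℝ) (U P Q Pxx Pxt Qtt : ℝ × ℝ → ℝ),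
      IsSolutionWithDerivs p a ε f g T U P Q Pxx Pxt Qtt → 0 ≤ ε → ContDiff ℝ 1 f →
      Continuous g → (∀ x, 0 ≤ f x) → f R = 0 → (∀ x, R ≤ x → deriv f x = 0) →
      (∀ x, R ≤ x → g x = 0) → 1 ≤ T₀ → T₀ < T →
      ε * ∫ y in (-R)..R, (g y * (y + R) + f y) ≤ C * weightPrimitive a T₀ ^ (-(1 / (p - 1))) := by
  obtain ⟨c₀, hc₀, hw⟩ := exists_weight_le_weightPrimitive ha
  have hp1 : 0 < p - 1 := by linarith
  obtain ⟨n, hn⟩ := exists_nat_ge (2 / (p - 1))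
  have hn' : ((n : ℝ) + 2) / p ≤ n := by
    rw [div_le_iff₀ hp1] at hn
    rw [div_le_iff₀ (by linarith)]
    linarith
  set c : ℝ := (2 + R) ^ (-|a|) with hc
  have hc0 : 0 < c := by positivity
  -- Here `n + 2` comes from differentiating the power, `2` from `2|η'|`, `(n + 1) c₀` from the
  -- `(θ')²` term of `η''`, and `|a|` from `q'`.
  set C₁ : ℝ := (n + 2) * (2 + R * ((n + 1) * c₀ + |a|)) with hC₁
  have hC₁0 : 0 < C₁ := by positivity
  refine ⟨4 * R ^ 2 * (C₁ * (C₁ / c) ^ (1 / (p - 1))), by positivity, ?_⟩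
  intro ε T T₀ f g U P Q Pxx Pxt Qtt h hε hf hg hf0 hfR hf'R hgR hT₀ hT₀T
  set S := weightPrimitive a T₀ with hS
  have hS0 : 0 < S := weightPrimitive_pos ha (by linarith)
  set M := C₁ * (C₁ / c) ^ (1 / (p - 1)) * S ^ (-(p / (p - 1))) with hM
  set q : ℝ → ℝ := fun t => (1 + t) ^ (-a) with hq
  set q' : ℝ → ℝ := fun t => -a * (1 + t) ^ (-a - 1) with hq'
  set θ : ℝ → ℝ := fun t => 1 - weightPrimitive a t / S with hθ
  set η : ℝ → ℝ := fun t => θ t ^ (n + 2) with hη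
  set η' : ℝ → ℝ := fun t => (n + 2) * θ t ^ (n + 1) * (-(q t / S)) with hη'
  set η'' : ℝ → ℝ := fun t => (n + 2) * ((n + 1) * θ t ^ n * (-(q t / S))) * (-(q t / S)) +
    (n + 2) * θ t ^ (n + 1) * (-(q' t / S)) with hη''
  have dq : ∀ t, 0 ≤ t → HasDerivAt q (q' t) t := fun t ht => hasDerivAt_one_add_rpow (-a) ht
  have dq' : ∀ t, 0 ≤ t → ContinuousAt q' t := fun t ht =>
    (continuousAt_const).mul (hasDerivAt_one_add_rpow (-a - 1) ht).continuousAt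
  have dθ : ∀ t, 0 ≤ t → HasDerivAt θ (-(q t / S)) t := fun t ht =>
    ((hasDerivAt_weightPrimitive a ht).div_const S).const_sub 1
  have dη : ∀ t, 0 ≤ t → HasDerivAt η (η' t) t := fun t ht => by
    refine ((dθ t ht).pow (n + 2)).congr_deriv ?_
    simp only [hη']
    push_cast
    simp
  have dη' : ∀ t, 0 ≤ t → HasDerivAt η' (η'' t) t := fun t ht => by
    refine ((((dθ t ht).pow (n + 1)).const_mul ((n : ℝ) + 2)).mul
      ((dq t ht).div_const S).neg).congr_deriv ?_
    simp only [hη'', Nat.add_sub_cancel, Pi.pow_apply, Pi.neg_apply]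
    push_cast
    ring
  have cη'' : ∀ t, 0 ≤ t → ContinuousAt η'' t := fun t ht => by
    have h1 := (dθ t ht).continuousAt
    have h2 := (dq t ht).continuousAt
    have h3 := dq' t ht
    exact (((continuousAt_const.mul (continuousAt_const.mul (h1.pow n) |>.mul
      (h2.div_const S).neg)).mul (h2.div_const S).neg)).add
      ((continuousAt_const.mul (h1.pow (n + 1))).mul (h3.div_const S).neg)
  have hqpos : ∀ t, 0 ≤ t → 0 < q t := fun t ht => by simp only [hq]; positivity
  have hWmono : MonotoneOn (weightPrimitive a) (Icc 0 T₀) :=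
    monotoneOn_Icc_of_hasDerivAt_nonneg (f' := q)
      (fun t ht => (hasDerivAt_weightPrimitive a ht.1).continuousAt.continuousWithinAt)
      (fun t ht => hasDerivAt_weightPrimitive a ht.1.le) (fun t ht => (hqpos t ht.1.le).le)
  have hθ01 : ∀ t ∈ Icc 0 T₀, 0 ≤ θ t ∧ θ t ≤ 1 := by
    intro t ht
    have h1 := hWmono (left_mem_Icc.2 (by linarith)) ht ht.1
    have h2 := hWmono ht (right_mem_Icc.2 (by linarith)) ht.2
    rw [weightPrimitive_zero] at h1
    refine ⟨sub_nonneg.2 ((div_le_one hS0).2 h2), ?_⟩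
    have : 0 ≤ weightPrimitive a t / S := by positivity
    simp only [hθ]; linarith
  have hcut : ∀ t ∈ Icc 0 T₀, 2 * |η' t| + |η'' t| * R ≤ C₁ * (θ t ^ n * q t / S) := by
    intro t ht
    obtain ⟨h0, h1⟩ := hθ01 t ht
    have hq0 := hqpos t ht.1
    have hr0 : 0 ≤ q t / S := by positivity
    have hqS : q t / S ≤ c₀ := by
      rw [div_le_iff₀ hS0]; exact hw T₀ hT₀ t ht.1 ht.2
    have hθn : θ t ^ (n + 1) ≤ θ t ^ n := pow_le_pow_of_le_one h0 h1 (Nat.le_succ n)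
    have hθn0 : 0 ≤ θ t ^ n := by positivity
    have hqq : |q' t| ≤ |a| * q t := by
      have ht1 : 1 ≤ 1 + t := by linarith [ht.1]
      have : 0 ≤ (1 + t) ^ (-a - 1) := Real.rpow_nonneg (by linarith) _
      simp only [hq', hq]
      rw [abs_mul, abs_neg, abs_of_nonneg this]
      gcongr
      linarith
    have e1 : |η' t| ≤ (n + 2) * (θ t ^ n * q t / S) := by
      have : |η' t| = (n + 2) * (θ t ^ (n + 1) * (q t / S)) := by
        simp only [hη', abs_mul, abs_neg]
        rw [abs_of_nonneg hr0, abs_of_nonneg (by positivity : (0 : ℝ) ≤ n + 2),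
          abs_of_nonneg (by positivity)]
        ring
      rw [this, mul_div_assoc]
      gcongr
    have e2 : |η'' t| ≤ (n + 2) * ((n + 1) * c₀ + |a|) * (θ t ^ n * q t / S) := by
      have i1 : |(n + 2) * ((n + 1) * θ t ^ n * (-(q t / S))) * (-(q t / S))| ≤
          (n + 2) * ((n + 1) * c₀) * (θ t ^ n * q t / S) := by
        have : (n + 2) * ((n + 1) * θ t ^ n * (-(q t / S))) * (-(q t / S)) =
          (n + 2) * ((n + 1) * (q t / S)) * (θ t ^ n * q t / S) := by ring
        rw [this, abs_of_nonneg (by positivity)]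
        gcongr
      have i2 : |(n + 2) * θ t ^ (n + 1) * (-(q' t / S))| ≤
          (n + 2) * |a| * (θ t ^ n * q t / S) := by
        rw [abs_mul, abs_neg, abs_div, abs_of_pos hS0,
          abs_of_nonneg (by positivity : 0 ≤ ((n : ℝ) + 2) * θ t ^ (n + 1))]
        calc _ ≤ (n + 2) * θ t ^ n * (|a| * q t / S) := by gcongr
          _ = _ := by ring
      calc |η'' t| ≤ _ := abs_add_le _ _
        _ ≤ _ := add_le_add i1 i2
        _ = _ := by ring
    calc 2 * |η' t| + |η'' t| * R ≤ 2 * ((n + 2) * (θ t ^ n * q t / S)) +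
          (n + 2) * ((n + 1) * c₀ + |a|) * (θ t ^ n * q t / S) * R := by gcongr
      _ = _ := by rw [hC₁]; ring
  have hmono : MonotoneOn (fun t => testFunctional R U P Q η η' t +
      4 * R ^ 2 * M * weightPrimitive a t) (Icc 0 T₀) := by
    have hfun : ∀ t ∈ Ioo 0 T₀, _ := fun t (ht : t ∈ Ioo 0 T₀) =>
      h.hasDerivAt_testFunctional (by linarith) hR.le ht.1
      (ht.2.trans hT₀T) (η := η) (η' := η') (η'' := η'') (fun t h0 _ => dη t h0.le)
      (fun t h0 _ => dη' t h0.le) (fun t ht => (cη'' t ht.1.le).continuousWithinAt)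
      (h.eq_zero_on_char hp hf'R hgR hfR ht.1.le (ht.2.trans hT₀T))
      (h.derivs_eq_zero hp hf'R hgR ht.1.le (ht.2.trans hT₀T) (by linarith)).1
      (h.derivs_eq_zero hp hf'R hgR ht.1.le (ht.2.trans hT₀T) (by linarith)).2
    refine monotoneOn_Icc_of_hasDerivAt_nonneg ?_ (fun t ht => (hfun t ht).2.add
      ((hasDerivAt_weightPrimitive a ht.1.le).const_mul (4 * R ^ 2 * M))) ?_
    · exact (h.continuousOn_testFunctional hR.le hT₀T
        (fun t ht => (dη t ht.1).continuousAt.continuousWithinAt)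
        (fun t ht => (dη' t ht.1).continuousAt.continuousWithinAt)).add
        (continuousOn_const.mul fun t ht =>
          (hasDerivAt_weightPrimitive a ht.1).continuousAt.continuousWithinAt)
    · intro t ht
      have hle := intervalIntegral.integral_mono_on (by linarith : -R ≤ R)
        (intervalIntegrable_const (μ := volume) (c := -(2 * R * q t * M)))
        ((hfun t ht).1.intervalIntegrable_of_Icc (by linarith)) (fun y hy => by
          obtain ⟨h0, h1⟩ := hθ01 t (Ioo_subset_Icc_self ht)
          rw [div_eq_mul_inv (|P (y + t, t)| ^ p)]
          exact neg_le_mul_rpow_sub_mul_add hp hn' h0 h1 hc0 hC₁0.le (hqpos t ht.1.le) hS0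
            (mul_one_add_rpow_le_japaneseBracket_rpow hR.le (abs_le.2 hy) ht.1.le)
            (by linarith [hy.1]) (by linarith [hy.2]) (hcut t (Ioo_subset_Icc_self ht)))
      rw [intervalIntegral.integral_const, smul_eq_mul] at hle
      have : (R - -R) * -(2 * R * q t * M) = -(4 * R ^ 2 * M * (1 + t) ^ (-a)) := by
        simp only [hq]; ring
      linarith
  have hfin := hmono (left_mem_Icc.2 (by linarith)) (right_mem_Icc.2 (by linarith))
    (by linarith : (0 : ℝ) ≤ T₀)
  have hθT : θ T₀ = 0 := by simp only [hθ]; rw [← hS, div_self hS0.ne', sub_self]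
  have hET : testFunctional R U P Q η η' T₀ = 0 := by
    simp [testFunctional, hη, hη', hθT]
  have hθ0 : θ 0 = 1 := by simp [hθ, weightPrimitive_zero]
  have hη0 : η 0 = 1 := by simp [hη, hθ0]
  -- As `f ≥ 0`, the term with `η' 0` has a favourable sign and can be dropped.
  have hη'0 : η' 0 ≤ 0 := by
    have : 0 ≤ q 0 / S := div_nonneg (hqpos 0 le_rfl).le hS0.le
    simp only [hη', hθ0, one_pow, mul_one, mul_neg]
    exact neg_nonpos.2 (by positivity)
  have hint : 0 ≤ ∫ y in (-R)..R, f y * (y + R) :=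
    intervalIntegral.integral_nonneg (by linarith) fun y hy =>
      mul_nonneg (hf0 y) (by linarith [hy.1])
  simp only [hET, weightPrimitive_zero, ← hS] at hfin
  rw [h.testFunctional_zero hf hg hfR, hη0] at hfin
  have h3 : η' 0 * (ε * ∫ y in (-R)..R, f y * (y + R)) ≤ 0 :=
    mul_nonpos_of_nonpos_of_nonneg hη'0 (mul_nonneg hε hint)
  have h4 : 4 * R ^ 2 * M * S =
      4 * R ^ 2 * (C₁ * (C₁ / c) ^ (1 / (p - 1))) * S ^ (-(1 / (p - 1))) := by
    have : S ^ (-(1 / (p - 1))) = S ^ (-(p / (p - 1))) * S := by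
      rw [← Real.rpow_add_one hS0.ne']
      congr 1
      field_simp
      ring
    rw [hM, this]; ring
  linarith

/-! ### Bounds on the existence time -/

theorem IsClassicalSolution.mono {p a ε : ℝ} {f g : ℝ → ℝ} {T T' : EReal} {u : ℝ → ℝ → ℝ}
    (h : IsClassicalSolution p a ε f g T u) (hT : T' ≤ T) :
    IsClassicalSolution p a ε f g T' u where
  contDiffOn := h.contDiffOn.mono fun _ hz => ⟨hz.1, hz.2.trans_le hT⟩
  equation x t h0 h1 := h.equation x t h0 (h1.trans_le hT)
  initial_value := h.initial_value
  initial_velocity := h.initial_velocity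

theorem lifespan_le_of_forall_not_exists {p a ε : ℝ} {f g : ℝ → ℝ} {b : EReal}
    (h : ∀ T : EReal, b < T → ¬ ∃ u : ℝ → ℝ → ℝ, IsClassicalSolution p a ε f g T u) :
    lifespan p a ε f g ≤ b :=
  sSup_le fun T hT => not_lt.1 fun hb => h T hb hT.2

/-- The bound on the existence time in terms of the primitive of the weight. -/
theorem exists_weightPrimitive_le {p a R : ℝ} (hp : 1 < p) (ha : a ≤ 1) (hR : 0 ≤ R)
    {f g : ℝ → ℝ} (hf : ContDiff ℝ 1 f) (hg : Continuous g)
    (hfsupp : tsupport f ⊆ {x : ℝ | |x| ≤ R}) (hgsupp : tsupport g ⊆ {x : ℝ | |x| ≤ R})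
    (hf0 : ∀ x, 0 ≤ f x) (hg0 : ∀ x, 0 ≤ g x) (hne : (∃ x, f x ≠ 0) ∨ (∃ x, g x ≠ 0)) :
    ∃ K : ℝ, 0 < K ∧ ∀ (ε T₀ : ℝ) (T : EReal) (u : ℝ → ℝ → ℝ), 0 < ε → 1 ≤ T₀ → (T₀ : EReal) < T →
      IsClassicalSolution p a ε f g T u → weightPrimitive a T₀ ≤ K * ε ^ (-(p - 1)) := by
  have hp1 : 0 < p - 1 := by linarith
  -- With `R + 1` in place of `R`, the data vanish near the right end of the strip, and the weight
  -- `y + (R + 1)` is strictly positive on their support, which gives `D > 0`.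
  obtain ⟨C, hC, hbound⟩ := exists_data_le_weightPrimitive_rpow hp ha (by linarith : 0 < R + 1)
  have hnf : ∀ x, R + 1 ≤ x → x ∉ tsupport f := fun x hx hmem => by
    have : |x| ≤ R := hfsupp hmem
    linarith [le_abs_self x]
  have hng : ∀ x, R + 1 ≤ x → x ∉ tsupport g := fun x hx hmem => by
    have : |x| ≤ R := hgsupp hmem
    linarith [le_abs_self x]
  set D := ∫ y in (-(R + 1))..(R + 1), (g y * (y + (R + 1)) + f y) with hD
  have hD0 : 0 < D := by
    have hfc := hf.continuous
    have := intervalIntegral.integral_lt_integral_of_continuousOn_of_le_of_exists_lt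
      (by linarith : -(R + 1) < R + 1) (continuousOn_const (c := (0 : ℝ)))
      (by fun_prop : Continuous fun y => g y * (y + (R + 1)) + f y).continuousOn
      (fun x hx => add_nonneg (mul_nonneg (hg0 x) (by linarith [hx.1])) (hf0 x)) ?_
    · rwa [intervalIntegral.integral_zero] at this
    rcases hne with ⟨x, hx⟩ | ⟨x, hx⟩
    · have h1 : |x| ≤ R := hfsupp (subset_tsupport f hx)
      have h2 := abs_le.1 h1
      exact ⟨x, ⟨by linarith, by linarith⟩, add_pos_of_nonneg_of_pos
        (mul_nonneg (hg0 x) (by linarith)) ((hf0 x).lt_of_ne' hx)⟩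
    · have h1 : |x| ≤ R := hgsupp (subset_tsupport g hx)
      have h2 := abs_le.1 h1
      exact ⟨x, ⟨by linarith, by linarith⟩, add_pos_of_pos_of_nonneg
        (mul_pos ((hg0 x).lt_of_ne' hx) (by linarith)) (hf0 x)⟩
  refine ⟨(C / D) ^ (p - 1), by positivity, ?_⟩
  intro ε T₀ T u hε hT₀ hT hu
  -- A finite end time beyond `T₀` is chosen, since `T` may be `∞`.
  obtain ⟨T₁, hT₁, hT₁T⟩ := EReal.lt_iff_exists_real_btwn.1 hT
  have hT₁' : T₀ < T₁ := by exact_mod_cast hT₁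
  obtain ⟨P, Q, Pxx, Pxt, Qtt, h⟩ := (hu.mono hT₁T.le).exists_isSolutionWithDerivs (by linarith)
    (hf.differentiable (by norm_num))
  have hS := weightPrimitive_pos ha (by linarith : 0 < T₀)
  set S := weightPrimitive a T₀
  have key : ε * D ≤ C * S ^ (-(1 / (p - 1))) :=
    hbound ε T₁ T₀ f g _ P Q Pxx Pxt Qtt h hε.le hf hg hf0
      (image_eq_zero_of_notMem_tsupport (hnf _ le_rfl))
      (fun x hx => (HasDerivAt.of_notMem_tsupport (hnf x hx)).deriv)
      (fun x hx => image_eq_zero_of_notMem_tsupport (hng x hx)) hT₀ hT₁'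
  rw [Real.rpow_neg hS.le, ← div_eq_mul_inv, le_div_iff₀ (by positivity)] at key
  have h1 : S ^ (1 / (p - 1)) ≤ C / D * ε⁻¹ := by
    rw [← div_eq_mul_inv, div_div, le_div_iff₀ (by positivity)]
    linarith
  calc S = (S ^ (1 / (p - 1))) ^ (p - 1) := by
        rw [← Real.rpow_mul hS.le, one_div_mul_cancel hp1.ne', Real.rpow_one]
    _ ≤ (C / D * ε⁻¹) ^ (p - 1) := by gcongr
    _ = _ := by rw [Real.mul_rpow (by positivity) (by positivity), Real.rpow_neg hε.le,
        Real.inv_rpow hε.le]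

theorem theorem2p1 (p a R : ℝ) (hp : 1 < p) (hR : 1 ≤ R) (f g : ℝ → ℝ)
    (hf : ContDiff ℝ 2 f) (hg : ContDiff ℝ 1 g)
    (hfsupp : tsupport f ⊆ {x : ℝ | |x| ≤ R}) (hgsupp : tsupport g ⊆ {x : ℝ | |x| ≤ R})
    (hf_nonneg : ∀ x, 0 ≤ f x) (hg_nonneg : ∀ x, 0 ≤ g x)
    (hne : (∃ x, f x ≠ 0) ∨ (∃ x, g x ≠ 0)) :
    ∃ ε₁ : ℝ, 0 < ε₁ ∧ ∃ C : ℝ, 0 < C ∧ ∀ ε : ℝ, 0 < ε → ε ≤ ε₁ →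
      (a < 1 →
        (∀ T : EReal, ((C * ε ^ (-((p - 1) / (1 - a))) : ℝ) : EReal) < T →
          ¬ ∃ u : ℝ → ℝ → ℝ, IsClassicalSolution p a ε f g T u) ∧
        lifespan p a ε f g ≤ ((C * ε ^ (-((p - 1) / (1 - a))) : ℝ) : EReal)) ∧
      (a = 1 →
        (∀ T : EReal, ((Real.exp (C * ε ^ (-(p - 1))) : ℝ) : EReal) < T →
          ¬ ∃ u : ℝ → ℝ → ℝ, IsClassicalSolution p a ε f g T u) ∧
        lifespan p a ε f g ≤ ((Real.exp (C * ε ^ (-(p - 1))) : ℝ) : EReal)) := by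

  rcases lt_trichotomy a 1 with ha | ha | ha
  · obtain ⟨K, hK, hbound⟩ := exists_weightPrimitive_le hp ha.le (by linarith)
      (hf.of_le (by norm_num)) hg.continuous hfsupp hgsupp hf_nonneg hg_nonneg hne
    obtain ⟨c, hc, hlow⟩ := exists_mul_rpow_le_weightPrimitive ha
    have ha' : 0 < 1 - a := by linarith
    -- With `ε ≤ 1`, the maximum with `1` forces `T₀ ≥ 1`, as the bounds on the primitive require.
    refine ⟨1, one_pos, max 1 ((K / c) ^ (1 / (1 - a))), by positivity, fun ε hε hε1 =>
      ⟨fun _ => ?_, fun h => absurd h ha.ne⟩⟩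
    have hno : ∀ T : EReal,
        ((max 1 ((K / c) ^ (1 / (1 - a))) * ε ^ (-((p - 1) / (1 - a))) : ℝ) : EReal) < T →
          ¬ ∃ u : ℝ → ℝ → ℝ, IsClassicalSolution p a ε f g T u := by
      rintro T hT ⟨u, hu⟩
      obtain ⟨T₀, hT₀, hT₀T⟩ := EReal.lt_iff_exists_real_btwn.1 hT
      rw [EReal.coe_lt_coe_iff] at hT₀
      have hε' : 1 ≤ ε ^ (-((p - 1) / (1 - a))) := by
        refine Real.one_le_rpow_of_pos_of_le_one_of_nonpos hε hε1 (neg_nonpos.2 ?_)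
        exact div_nonneg (by linarith) ha'.le
      have h1 : 1 ≤ T₀ := (one_le_mul_of_one_le_of_one_le (le_max_left _ _) hε').trans hT₀.le
      have h2 := (hlow T₀ h1).trans (hbound ε T₀ T u hε h1 hT₀T hu)
      have h3 : (1 + T₀) ^ (1 - a) ≤ K / c * ε ^ (-(p - 1)) := by
        rw [div_mul_eq_mul_div, le_div_iff₀ hc]
        linarith
      have h4 : 1 + T₀ ≤ (K / c) ^ (1 / (1 - a)) * ε ^ (-((p - 1) / (1 - a))) := by
        calc 1 + T₀ = ((1 + T₀) ^ (1 - a)) ^ (1 / (1 - a)) := by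
              rw [← Real.rpow_mul (by linarith), mul_one_div_cancel ha'.ne', Real.rpow_one]
          _ ≤ (K / c * ε ^ (-(p - 1))) ^ (1 / (1 - a)) := by gcongr
          _ = _ := by
              rw [Real.mul_rpow (by positivity) (by positivity), ← Real.rpow_mul hε.le]
              congr 2
              ring
      have h5 : (K / c) ^ (1 / (1 - a)) * ε ^ (-((p - 1) / (1 - a))) ≤
          max 1 ((K / c) ^ (1 / (1 - a))) * ε ^ (-((p - 1) / (1 - a))) := by
        gcongr
        exact le_max_right _ _
      linarith
    exact ⟨hno, lifespan_le_of_forall_not_exists hno⟩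
  · obtain ⟨K, hK, hbound⟩ := exists_weightPrimitive_le hp ha.le (by linarith)
      (hf.of_le (by norm_num)) hg.continuous hfsupp hgsupp hf_nonneg hg_nonneg hne
    refine ⟨1, one_pos, K, hK, fun ε hε _ => ⟨fun h => absurd ha h.ne, fun _ => ?_⟩⟩
    have hno : ∀ T : EReal, ((Real.exp (K * ε ^ (-(p - 1))) : ℝ) : EReal) < T →
          ¬ ∃ u : ℝ → ℝ → ℝ, IsClassicalSolution p a ε f g T u := by
      rintro T hT ⟨u, hu⟩
      obtain ⟨T₀, hT₀, hT₀T⟩ := EReal.lt_iff_exists_real_btwn.1 hT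
      rw [EReal.coe_lt_coe_iff] at hT₀
      have h1 : 1 ≤ T₀ := (Real.one_le_exp (by positivity)).trans hT₀.le
      have h2 := hbound ε T₀ T u hε h1 hT₀T hu
      rw [weightPrimitive, if_pos ha, Real.log_le_iff_le_exp (by linarith)] at h2
      linarith
    exact ⟨hno, lifespan_le_of_forall_not_exists hno⟩
  · exact ⟨1, one_pos, 1, one_pos, fun ε _ _ =>
      ⟨fun h => absurd h ha.not_gt, fun h => absurd h ha.ne'⟩⟩
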